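/- Let $\mathbb F$ be a finite field, $n\ge 1$, $\mathcal I=\{0,\dots,n-1\}$ (computed modulo $n$), and let $\mathcal C\subseteq\mathbb F^n$ be a linear code of dimension $k$ such that for each $j\in\mathcal I$ some word of $\mathcal C$ and some word of the dual code $\mathcal C^\perp$ is nonzero at position $j$. **Spans and characteristic pairs.** For $a,b\in\mathcal I$ let $[a,b]=\{a,\dots,b\}$ if $a\le b$ and $[a,b]=\{a,\dots,n-1,0,\dots,b\}$ if $a>b$; let $(a,b]=[a,b]\setminus\{a\}$. The interval $(a,b]$ is a span of $c\in\mathbb F^n\setminus\{0\}$ if $c_a\ne0\ne c_b$ and $[a,b]$ contains the support of $c$. A characteristic pair of $\mathcal C$ is a pair $(X,\mathcal T)$ of a matrix $X\in\mathbb F^{n\times n}$ and a list $\mathcal T=[(a_l,b_l]\mid l=1,\dots,n]$ such that the rows $x_l$ of $X$ generate $\mathcal C$; $(a_l,b_l]$ is a span of $x_l$ for each $l$; $a_1,\dots,a_n$ are distinct and $b_1,\dots,b_n$ are distinct; and each $j\in\mathcal I$ lies in exactly $n-k$ of the spans $(a_l,b_l]$. Then $X$ is called a characteristic matrix of $\mathcal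 C$. For $\mathcal C^\perp$ the definition is the same, with $n-k$ in place of $k$. **Trellises.** A linear trellis $T$ of depth $n$ consists of finite-dimensional $\mathbb F$-vector spaces $V_j$ and subspaces $E_j\subseteq V_j\times\mathbb F\times V_{j+1}$, $j\in\mathcal I$. Trellises $T,T'$ are isomorphic if there are linear isomorphisms $\phi_j:V_j\to V'_j$ with $(v,a,w)\in E_j\Leftrightarrow(\phi_j(v),a,\phi_{j+1}(w))\in E'_j$. The local dual $T^\circ$ has state spaces $\hat V_j$ paired with $V_j$ by non-degenerate bilinear forms $\langle\cdot,\cdot\rangle$, and transition spaces $$(E_j)^\circ=\{(\hat v,b,\hat w)\in\hat V_j\times\mathbb F\times\hat V_{j+1}\mid \langle v,\hat v\rangle+ab-\langle w,\hat w\rangle=0\text{ for all }(v,a,w)\in E_j\};$$ up to isomorphism it does not depend on the choice of $\hat V_j$ and the forms (for instance, $\hat V_j$ may be the space of linear functionals on $V_j$). Two trellises are dual to each other if each is isomorphic to the local dual of the other. For a matrix $G$ with $r$ rows and columns $G_0^{\mathsf T},\dots,G_{n-1}^{\mathsf T}$, and a list $\mathcal S$ of spans of its rows, the product trellis $T_{G,\mathcal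 S}$ has $V_j=\operatorname{im}M_j$ and $E_j=\operatorname{im}(M_j,G_j^{\mathsf T},M_{j+1})$, where $\operatorname{im}$ is the row space and $M_j\in\mathbb F^{r\times r}$ is the diagonal matrix whose $l$-th diagonal entry is $1$ if $j$ lies in the $l$-th span and $0$ otherwise. **Theorem.** For every characteristic pair $(X,\mathcal T)$ of $\mathcal C$, $\mathcal T=[(a_l,b_l]\mid l=1,\dots,n]$, there is a matrix $Y\in\mathbb F^{n\times n}$ such that $(Y,\hat{\mathcal T})$ with $\hat{\mathcal T}=[(b_l,a_l]\mid l=1,\dots,n]$ is a characteristic pair of $\mathcal C^\perp$ and the following holds. *Construction of $Y$.* Let $H\in\mathbb F^{(n-k)\times n}$ be any matrix of full row rank with $\mathcal C=\{c\mid cH^{\mathsf T}=0\}$, and let $H_i^{\mathsf T}$ be its columns. For $j\in\mathcal I$ let $N_j\in\mathbb F^{n\times(n-k)}$ be the matrix with $l$-th row $\sum_{i=a_l}^{n-1}x_{li}H_i+\sum_{i=0}^{j-1}x_{li}H_i$. Then for each $m$ there is a unique $v_m\in\mathbb F^{n-k}$ such that $x_{l,b_m}=\operatorname{row}(N_{b_m+1},l)\,v_m^{\mathsf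 T}$ for all $l\ne m$, and the $m$-th row of $Y$ is $v_mH$. *Duality.* Let $(\tilde X,\tilde Y)$ be any dual selection, that is, $\tilde X\in\mathbb F^{k\times n}$ consists of $k$ rows of $X$, with list of spans $\mathcal S\subseteq\mathcal T$, and $\tilde Y\in\mathbb F^{(n-k)\times n}$ consists of the rows of $Y$ with spans in $\hat{\mathcal S}=\hat{\mathcal T}\setminus[(b,a]\mid(a,b]\in\mathcal S]$. Then 1. $\operatorname{rk}\tilde X=k$ if and only if $\operatorname{rk}\tilde Y=n-k$. 2. If $\operatorname{rk}\tilde X=k$, then the trellises $T_{\tilde X,\mathcal S}$ and $T_{\tilde Y,\hat{\mathcal S}}$ are dual to each other. -/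

import Mathlib

universe u

namespace KVTrellis

/-! Codes of length `n` over a field `F` are subspaces of `Fin n → F`. The time axis is `Fin n`;
addition in `Fin n` is modulo `n`, so `j + 1` is the cyclic successor of `j`. -/

section Codes

variable {F : Type u} [Field F] {n : ℕ}

/-- The dual code, with respect to the standard bilinear form. -/
def dualCode (C : Submodule F (Fin n → F)) : Submodule F (Fin n → F) where
  carrier := {d | ∀ c ∈ C, c ⬝ᵥ d = 0}
  zero_mem' := fun c _ => dotProduct_zero c
  add_mem' := fun {d e} hd he c hc => by rw [dotProduct_add, hd c hc, he c hc, add_zero]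
  smul_mem' := fun t d hd c hc => by rw [dotProduct_smul, hd c hc, smul_zero]

/-- Every coordinate is nonzero in some codeword. -/
def FullSupport (C : Submodule F (Fin n → F)) : Prop :=
  ∀ j, ∃ c ∈ C, c j ≠ 0

/-- `H` has linearly independent rows and `C = {c | c Hᵀ = 0}`; so it has `n - dim C` rows. -/
def IsParityCheck {r : ℕ} (C : Submodule F (Fin n → F)) (H : Matrix (Fin r) (Fin n) F) : Prop :=
  LinearIndependent F H.row ∧ ∀ c, c ∈ C ↔ Matrix.mulVec H c = 0

end Codes

section Spans

variable {F : Type u} [Field F] {n : ℕ}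

/-- The (conventional or circular) closed interval `[a, b]` of the time axis. -/
def closedInterval (a b : Fin n) : Finset (Fin n) :=
  if a ≤ b then Finset.univ.filter (fun j => a ≤ j ∧ j ≤ b)
  else Finset.univ.filter (fun j => a ≤ j ∨ j ≤ b)

/-- The half-open interval `(a, b] = [a, b] \ {a}`. -/
def halfOpen (a b : Fin n) : Finset (Fin n) :=
  (closedInterval a b).erase a

/-- `(s.1, s.2]` is a span of `c`; this forces `c ≠ 0`. -/
def IsSpan (c : Fin n → F) (s : Fin n × Fin n) : Prop :=
  c s.1 ≠ 0 ∧ c s.2 ≠ 0 ∧ ∀ j, c j ≠ 0 → j ∈ closedInterval s.1 s.2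

/-- `(X, T)` is a characteristic pair of `C`, where `T l = (a, b)` stands for the span `(a, b]`
of the `l`-th row of `X`. -/
structure IsCharPair (C : Submodule F (Fin n → F)) (X : Matrix (Fin n) (Fin n) F)
    (T : Fin n → Fin n × Fin n) : Prop where
  span_rows : Submodule.span F (Set.range X.row) = C
  isSpan : ∀ l, IsSpan (X.row l) (T l)
  start_injective : Function.Injective (fun l => (T l).1)
  end_injective : Function.Injective (fun l => (T l).2)
  card_cover : ∀ j, (Finset.univ.filter (fun l => j ∈ halfOpen (T l).1 (T l).2)).card
    = n - Module.finrank F C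

/-- The index sets `K` and `K'` of rows of `X` and `Y` define a dual selection of `(X, T)` and
`(Y, T')`: `k` rows of `X`, and the `n - k` rows of `Y` whose spans are those members of `T'`
that are not the reversal of a selected member of `T`. -/
structure IsDualSelection (k : ℕ) (T T' : Fin n → Fin n × Fin n) (K K' : Finset (Fin n)) :
    Prop where
  card_left : K.card = k
  card_right : K'.card = n - k
  complementary : K'.image T' = Finset.univ.image T' \ K.image (fun l => (T l).swap)

/-- The submatrix consisting of the rows with index in `K`. -/
def selectRows (X : Matrix (Fin n) (Fin n) F) (K : Finset (Fin n)) : Matrix K (Fin n) F :=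
  X.submatrix (fun l => (l : Fin n)) id

end Spans

/-- A linear (tail-biting) trellis of depth `n`: state spaces `V j` and transition spaces
`E j ⊆ V j × F × V (j + 1)`. -/
structure LinearTrellis (F : Type u) [Field F] (n : ℕ) [NeZero n] where
  V : Fin n → Type u
  [grp : ∀ j, AddCommGroup (V j)]
  [mod : ∀ j, Module F (V j)]
  [fin : ∀ j, Module.Finite F (V j)]
  E : ∀ j, Submodule F (V j × F × V (j + 1))

attribute [instance] LinearTrellis.grp LinearTrellis.mod LinearTrellis.fin

namespace LinearTrellis

variable {F : Type u} [Field F] {n : ℕ} [NeZero n]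

/-- Isomorphism of linear trellises. -/
def Isomorphic (T T' : LinearTrellis F n) : Prop :=
  ∃ φ : ∀ j, T.V j ≃ₗ[F] T'.V j,
    ∀ j v a w, (v, a, w) ∈ T.E j ↔ (φ j v, a, φ (j + 1) w) ∈ T'.E j

/-- The local dual of `T` with respect to dual state spaces `W j` and bilinear forms `B j` on
`V j × W j` (which should be non-degenerate): its transition spaces are the duals of the `E j`
with respect to `((v, a, w), (v', b, w')) ↦ B j v v' + a * b - B (j + 1) w w'`. -/
def localDualWith (T : LinearTrellis F n) (W : Fin n → Type u) [∀ j, AddCommGroup (W j)]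
    [∀ j, Module F (W j)] [∀ j, Module.Finite F (W j)]
    (B : ∀ j, T.V j →ₗ[F] W j →ₗ[F] F) : LinearTrellis F n where
  V := W
  E := fun j =>
    { carrier := {y | ∀ x ∈ T.E j,
        B j x.1 y.1 + x.2.1 * y.2.1 - B (j + 1) x.2.2 y.2.2 = 0}
      zero_mem' := fun x _ => by simp
      add_mem' := fun {y z} hy hz x hx => by
        have h1 := hy x hx
        have h2 := hz x hx
        simp only [Prod.fst_add, Prod.snd_add, map_add]
        linear_combination h1 + h2
      smul_mem' := fun t y hy x hx => by
        have h1 := hy x hx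
        simp only [Prod.smul_fst, Prod.smul_snd, map_smul, smul_eq_mul]
        linear_combination t * h1 }

/-- The local dual formed with the linear algebra duals of the state spaces and the evaluation
forms `(v, f) ↦ f v`. Up to isomorphism the local dual does not depend on the choice of the dual
state spaces and of the non-degenerate forms. -/
def localDual (T : LinearTrellis F n) : LinearTrellis F n :=
  T.localDualWith (fun j => Module.Dual F (T.V j)) (fun j => Module.Dual.eval F (T.V j))

/-- Each of the two trellises is, up to isomorphism, the local dual of the other one. -/
def DualToEachOther (T T' : LinearTrellis F n) : Prop :=
  T.localDual.Isomorphic T' ∧ T'.localDual.Isomorphic T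

end LinearTrellis

section Product

variable {F : Type u} [Field F] {n : ℕ} {ι : Type} [Fintype ι] [DecidableEq ι]

/-- The diagonal matrix `M_j` of a span list `S`, with entry `1` where `j` lies in the span. -/
def stateMatrix (F : Type u) [Field F] (S : ι → Fin n × Fin n) (j : Fin n) : Matrix ι ι F :=
  Matrix.diagonal (fun l => if j ∈ halfOpen (S l).1 (S l).2 then 1 else 0)

/-- The map `α ↦ α M_j`. -/
def stateMap (F : Type u) [Field F] (S : ι → Fin n × Fin n) (j : Fin n) :
    (ι → F) →ₗ[F] (ι → F) :=
  (stateMatrix F S j).vecMulLinear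

/-- The product trellis of `(G, S)`: the state spaces are the row spaces `im M_j` and the transition
spaces are the row spaces `im (M_j, G_j, M_{j+1})`, where `G_j` is the `j`-th column of `G`. -/
def productTrellis [NeZero n] (G : Matrix ι (Fin n) F) (S : ι → Fin n × Fin n) :
    LinearTrellis F n where
  V := fun j => LinearMap.range (stateMap F S j)
  E := fun j => LinearMap.range
    ((stateMap F S j).rangeRestrict.prod
      (((LinearMap.proj j).comp G.vecMulLinear).prod (stateMap F S (j + 1)).rangeRestrict))

end Product

section Construction

variable {F : Type u} [Field F] {n r : ℕ}

/-- Row `l` of the `j`-th state space matrix `N_j` of the BCJR-trellis of `(X, H, T)`, that is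
`∑_{i ≥ a_l} x_{li} H_i + ∑_{i < j} x_{li} H_i`, where `H_i` is the `i`-th column of `H`
and `a_l` the starting point of the `l`-th span. -/
def bcjrState (H : Matrix (Fin r) (Fin n) F) (X : Matrix (Fin n) (Fin n) F)
    (T : Fin n → Fin n × Fin n) (j l : Fin n) : Fin r → F :=
  (∑ i ∈ Finset.univ.filter (fun i => (T l).1 ≤ i), X l i • H.col i)
    + ∑ i ∈ Finset.univ.filter (fun i => i < j), X l i • H.col i

/-- With the `m`-th row omitted from `X` and from the matrices `N_j`, column `b_m` of `X` equals
`N_{b_m + 1} vᵀ`, where `b_m` is the end point of the `m`-th span. -/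
def IsDualState [NeZero n] (H : Matrix (Fin r) (Fin n) F) (X : Matrix (Fin n) (Fin n) F)
    (T : Fin n → Fin n × Fin n) (m : Fin n) (v : Fin r → F) : Prop :=
  ∀ l, l ≠ m → X l (T m).2 = bcjrState H X T ((T m).2 + 1) l ⬝ᵥ v

end Construction

end KVTrellis

/-! Read the inner product of row `l` of `X` with a word `y` of the dual code as a running sum along
the cyclic time axis, started at `a_l`. It vanishes at every time outside the span, so at time `j`
only the `n - k` active rows carry information. If all running sums vanish at one time, then so does
`y`: going backwards, the row starting at `j` forces `y j = 0`. By dimension, the dual code is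
therefore isomorphic at each time to the space of values on the active rows
(`IsCharPair.exists_partialSum`).

The `m`-th row of `Y` is the dual word whose running sums at `b_m + 1` are column `b_m` of `X`, with
entry `m` replaced by 0. One step back only the sum of row `m` survives, and it stays constant
through `(a_m, b_m]`, where the word vanishes except at `b_m` (`IsDualRow.partialSum_aux`). Hence
its span is `(b_m, a_m]`, and the rows active at any one time generate the dual code.

The rank claim is matroid duality: `Yᵀ D X = 0` for an invertible diagonal `D`, and the ranks of `X`
and `Y` add up to `n`. For the trellises, the running sums of selected rows of `X` against selected
rows of `Y` are matrices of pairings between the state spaces. Their recursion in `j` is exactly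
orthogonality of the transition spaces; nondegeneracy and a dimension count finish the proof. -/

namespace KVTrellis

/-! ### Circular intervals. -/

section Intervals

variable {n : ℕ}

theorem mem_halfOpen {a b j : Fin n} :
    j ∈ halfOpen a b ↔ j ≠ a ∧ ((a ≤ b ∧ a ≤ j ∧ j ≤ b) ∨ (b < a ∧ (a ≤ j ∨ j ≤ b))) := by
  unfold halfOpen closedInterval
  split_ifs with h <;> simp <;> grind

theorem mem_closedInterval_iff {a b j : Fin n} :
    j ∈ closedInterval a b ↔ j = a ∨ j ∈ halfOpen a b := by
  rw [mem_halfOpen]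
  unfold closedInterval
  split_ifs with h <;> simp <;> grind

theorem start_notMem_halfOpen (a b : Fin n) : a ∉ halfOpen a b := by
  simp [halfOpen]

theorem mem_halfOpen_swap {a b j : Fin n} (h : a ≠ b) :
    j ∈ halfOpen b a ↔ j ∉ halfOpen a b := by
  rw [mem_halfOpen, mem_halfOpen]; grind

theorem val_add_one_cases [NeZero n] (j : Fin n) :
    ((j + 1 : Fin n).val = j.val + 1) ∨ (j.val + 1 = n ∧ (j + 1 : Fin n).val = 0) := by
  have hj := j.isLt
  rw [Fin.val_add, Fin.val_one', Nat.add_mod_mod]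
  rcases Nat.lt_or_ge (j.val + 1) n with h | h
  · left; exact Nat.mod_eq_of_lt h
  · right
    have h' : j.val + 1 = n := by omega
    exact ⟨h', by rw [h', Nat.mod_self]⟩

theorem add_one_mem_halfOpen [NeZero n] {a b j : Fin n} (h : a ≠ b) :
    j + 1 ∈ halfOpen a b ↔ j = a ∨ (j ∈ halfOpen a b ∧ j ≠ b) := by
  rw [mem_halfOpen, mem_halfOpen]
  have h1 := val_add_one_cases j
  have h2 := (j + 1).isLt
  have ha := a.isLt
  have hb := b.isLt
  have hj := j.isLt
  simp only [Fin.le_def, Fin.lt_def, Fin.ext_iff, ne_eq] at *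
  omega

/-- Induction runs backwards in time, since the start of a row determines a word from its later
state. -/
theorem cyclic_induction [NeZero n] {Q : Fin n → Prop} (j₀ : Fin n) (h₀ : Q j₀)
    (step : ∀ j, Q (j + 1) → Q j) (j : Fin n) : Q j := by
  -- Here `t` is a number of forward steps leading from `i` to `j₀`.
  have key : ∀ (t : ℕ) (i : Fin n), (i.val + t) % n = j₀.val → Q i := by
    intro t
    induction t with
    | zero =>
      intro i hi
      have : i = j₀ := Fin.ext (by rw [← hi, add_zero, Nat.mod_eq_of_lt i.isLt])
      exact this ▸ h₀
    | succ t ih =>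
      intro i hi
      refine step i (ih _ ?_)
      rw [Fin.val_add, Fin.val_one', Nat.add_mod_mod, Nat.mod_add_mod, ← hi]
      congr 1; omega
  refine key (j₀.val + (n - j.val)) j ?_
  have hj := j.isLt
  rw [show j.val + (j₀.val + (n - j.val)) = j₀.val + n by omega, Nat.add_mod_right,
    Nat.mod_eq_of_lt j₀.isLt]

end Intervals

/-! ### Running inner products with dual words. -/

section PartialSums

variable {F : Type u} [Field F] {n : ℕ}

/-- The accumulated inner product of row `l` of `X` with a word, from the start of the `l`-th span
up to time `j`. -/
def partialSum (X : Matrix (Fin n) (Fin n) F) (T : Fin n → Fin n × Fin n) (j l : Fin n) :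
    (Fin n → F) →ₗ[F] F :=
  Fintype.linearCombination F
    (fun i => (if (T l).1 ≤ i then X l i else 0) + (if i < j then X l i else 0))

theorem partialSum_apply (X : Matrix (Fin n) (Fin n) F) (T : Fin n → Fin n × Fin n) (j l : Fin n)
    (y : Fin n → F) :
    partialSum X T j l y =
      ∑ i, y i * ((if (T l).1 ≤ i then X l i else 0) + (if i < j then X l i else 0)) := by
  simp [partialSum, Fintype.linearCombination_apply]

/-- Translates the BCJR states into running sums of the word `v H`, so that `H` plays no role in the
main argument. -/
theorem bcjrState_dotProduct {r : ℕ} (H : Matrix (Fin r) (Fin n) F)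
    (X : Matrix (Fin n) (Fin n) F) (T : Fin n → Fin n × Fin n) (j l : Fin n) (v : Fin r → F) :
    bcjrState H X T j l ⬝ᵥ v = partialSum X T j l (Matrix.vecMul v H) := by
  have hcol : ∀ i, H.col i ⬝ᵥ v = Matrix.vecMul v H i := fun i => dotProduct_comm _ _
  rw [partialSum_apply, bcjrState, add_dotProduct, sum_dotProduct, sum_dotProduct,
    Finset.sum_filter, Finset.sum_filter, ← Finset.sum_add_distrib]
  refine Finset.sum_congr rfl fun i _ => ?_
  simp only [smul_dotProduct, hcol, smul_eq_mul]
  split_ifs <;> ring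

variable {C : Submodule F (Fin n → F)} {X : Matrix (Fin n) (Fin n) F} {T : Fin n → Fin n × Fin n}

theorem IsCharPair.row_mem (hX : IsCharPair C X T) (l : Fin n) : X.row l ∈ C :=
  hX.span_rows ▸ Submodule.subset_span ⟨l, rfl⟩

theorem IsCharPair.sum_eq_zero (hX : IsCharPair C X T) (l : Fin n) {y : Fin n → F}
    (hy : y ∈ dualCode C) : ∑ i, X l i * y i = 0 :=
  hy _ (hX.row_mem l)

theorem IsCharPair.exists_start (hX : IsCharPair C X T) (j : Fin n) : ∃ l, (T l).1 = j :=
  Finite.surjective_of_injective hX.start_injective j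

theorem IsCharPair.start_ne_zero (hX : IsCharPair C X T) (l : Fin n) : X l (T l).1 ≠ 0 :=
  (hX.isSpan l).1

theorem IsCharPair.end_ne_zero (hX : IsCharPair C X T) (l : Fin n) : X l (T l).2 ≠ 0 :=
  (hX.isSpan l).2.1

theorem IsCharPair.entry_ne_zero (hX : IsCharPair C X T) {l j : Fin n} (h : X l j ≠ 0) :
    j = (T l).1 ∨ j ∈ halfOpen (T l).1 (T l).2 :=
  mem_closedInterval_iff.1 ((hX.isSpan l).2.2 j h)

theorem IsCharPair.start_ne_end (hX : IsCharPair C X T) (hC' : FullSupport (dualCode C))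
    (l : Fin n) : (T l).1 ≠ (T l).2 := by
  intro h
  obtain ⟨d, hd, hne⟩ := hC' (T l).1
  have h0 := hX.sum_eq_zero l hd
  rw [Finset.sum_eq_single (T l).1] at h0
  · exact mul_ne_zero (hX.start_ne_zero l) hne h0
  · intro i _ hi
    rw [mul_eq_zero]; left
    by_contra hx
    rcases hX.entry_ne_zero hx with h1 | h1
    · exact hi h1
    · rw [mem_halfOpen] at h1; grind
  · simp

theorem IsCharPair.partialSum_eq_zero (hX : IsCharPair C X T) {j l : Fin n}
    (hj : j ∉ halfOpen (T l).1 (T l).2) {y : Fin n → F} (hy : y ∈ dualCode C) :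
    partialSum X T j l y = 0 := by
  have h0 := hX.sum_eq_zero l hy
  have hs : ∀ i, X l i ≠ 0 → i = (T l).1 ∨ i ∈ halfOpen (T l).1 (T l).2 :=
    fun i hi => hX.entry_ne_zero hi
  rw [partialSum_apply]
  simp only [mem_halfOpen] at hj hs
  -- Outside the span the weight is constant on the support of row `l`, so the sum is a multiple of
  -- the full inner product. The value 2 arises when a conventional span ends before `j`.
  obtain ⟨c, hc⟩ : ∃ c : F, ∀ i, X l i ≠ 0 →
      (if (T l).1 ≤ i then (1 : F) else 0) + (if i < j then 1 else 0) = c := by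
    by_cases hab : (T l).1 ≤ (T l).2 ∧ (T l).2 < j
    · refine ⟨2, fun i hi => ?_⟩
      have := hs i hi
      rw [if_pos (by grind), if_pos (by grind)]; norm_num
    · refine ⟨1, fun i hi => ?_⟩
      have := hs i hi
      by_cases h1 : (T l).1 ≤ i
      · rw [if_pos h1, if_neg (by grind), add_zero]
      · rw [if_neg h1, if_pos (by grind), zero_add]
  have : c * ∑ i, X l i * y i = 0 := by rw [h0, mul_zero]
  rw [Finset.mul_sum] at this
  refine (Finset.sum_congr rfl fun i _ => ?_).trans this
  by_cases hi : X l i = 0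
  · simp [hi]
  · rw [← hc i hi]; split_ifs <;> ring

theorem IsCharPair.partialSum_add_one [NeZero n] (hX : IsCharPair C X T) (j l : Fin n)
    {y : Fin n → F} (hy : y ∈ dualCode C) :
    partialSum X T (j + 1) l y = partialSum X T j l y + X l j * y j := by
  have h0 := hX.sum_eq_zero l hy
  have hj : X l j * y j = ∑ i, if i = j then X l i * y i else 0 := by simp
  have hcases := val_add_one_cases j
  -- At the wrap from `n - 1` to `0` all weights drop by 1; this costs one full inner product, which
  -- is 0.
  obtain ⟨c, hc⟩ : ∃ c : F, ∀ i : Fin n,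
      (if i < j then (1 : F) else 0) + (if i = j then 1 else 0)
        = (if i < j + 1 then 1 else 0) + c := by
    rcases hcases with h | ⟨h, h'⟩
    · refine ⟨0, fun i => ?_⟩
      simp only [Fin.lt_def, Fin.ext_iff, h]
      rcases lt_trichotomy i.val j.val with h1 | h1 | h1
      · rw [if_pos h1, if_neg h1.ne, if_pos (by omega)]
      · rw [if_neg (by omega), if_pos h1, if_pos (by omega)]; ring
      · rw [if_neg (by omega), if_neg (by omega), if_neg (by omega)]
    · refine ⟨1, fun i => ?_⟩
      have hi := i.isLt
      simp only [Fin.lt_def, Fin.ext_iff, h']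
      rcases lt_or_ge i.val j.val with h1 | h1
      · rw [if_pos h1, if_neg h1.ne, if_neg (by omega)]; ring
      · rw [if_neg (by omega), if_pos (by omega), if_neg (by omega)]
  have h1 : ∑ i, c * (X l i * y i) = 0 := by rw [← Finset.mul_sum, h0, mul_zero]
  rw [hj, partialSum_apply, partialSum_apply, ← Finset.sum_add_distrib]
  refine (add_eq_left.2 h1).symm.trans ?_
  rw [← Finset.sum_add_distrib]
  refine Finset.sum_congr rfl fun i _ => ?_
  have := hc i
  have e1 : (if i < j then X l i else 0) = X l i * (if i < j then (1 : F) else 0) := by simp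
  have e2 : (if i < j + 1 then X l i else 0) = X l i * (if i < j + 1 then (1 : F) else 0) := by simp
  have e3 : (if i = j then X l i * y i else 0) = X l i * y i * (if i = j then (1 : F) else 0) := by
    simp
  rw [e1, e2, e3]
  linear_combination -(X l i * y i) * this

theorem IsCharPair.eq_zero_of_partialSum [NeZero n] (hX : IsCharPair C X T) (j₀ : Fin n)
    {y : Fin n → F} (hy : y ∈ dualCode C) (h : ∀ l, partialSum X T j₀ l y = 0) : y = 0 := by
  have step : ∀ j, (∀ l, partialSum X T (j + 1) l y = 0) → y j = 0 := by
    intro j hj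
    obtain ⟨l, rfl⟩ := hX.exists_start j
    have h1 := hX.partialSum_add_one (T l).1 l hy
    rw [hj l, hX.partialSum_eq_zero (start_notMem_halfOpen _ _) hy, zero_add] at h1
    exact (mul_eq_zero.1 h1.symm).resolve_left (hX.start_ne_zero l)
  have all : ∀ j, ∀ l, partialSum X T j l y = 0 := by
    refine cyclic_induction j₀ h fun j hj l => ?_
    have h1 := hX.partialSum_add_one j l hy
    rw [hj l, step j hj, mul_zero, add_zero] at h1
    exact h1.symm
  exact funext fun j => step j (all (j + 1))

end PartialSums

/-! ### Dimension of the dual code and parity check matrices. -/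

section Dimension

variable {F : Type u} [Field F] {n : ℕ}

theorem finrank_dualCode (C : Submodule F (Fin n → F)) :
    Module.finrank F (dualCode C) = n - Module.finrank F C := by
  have e : dualCode C = C.dualAnnihilator.comap (dotProductEquiv F (Fin n)).toLinearMap := by
    ext d
    simp only [Submodule.mem_comap, Submodule.mem_dualAnnihilator]
    exact forall₂_congr fun c _ => by
      rw [show ((dotProductEquiv F (Fin n)).toLinearMap d) c = d ⬝ᵥ c from rfl, dotProduct_comm]
  have h := Subspace.finrank_add_finrank_dualAnnihilator_eq C
  rw [Module.finrank_fin_fun] at h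
  rw [e, LinearEquiv.finrank_eq ((dotProductEquiv F (Fin n)).submoduleMap _),
    Submodule.map_comap_eq_of_surjective (dotProductEquiv F (Fin n)).surjective]
  omega

theorem finrank_code_le (C : Submodule F (Fin n → F)) : Module.finrank F C ≤ n := by
  simpa using Submodule.finrank_le C

theorem vecMul_mem_dualCode {r : ℕ} {C : Submodule F (Fin n → F)} {H : Matrix (Fin r) (Fin n) F}
    (hH : IsParityCheck C H) (v : Fin r → F) : Matrix.vecMul v H ∈ dualCode C := by
  intro c hc
  rw [dotProduct_comm, ← Matrix.dotProduct_mulVec, (hH.2 c).1 hc, dotProduct_zero]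

theorem vecMul_bijective {r : ℕ} {C : Submodule F (Fin n → F)} {H : Matrix (Fin r) (Fin n) F}
    (hH : IsParityCheck C H) :
    Function.Bijective (H.vecMulLinear.codRestrict (dualCode C) (vecMul_mem_dualCode hH)) := by
  have hinj : Function.Injective
      (H.vecMulLinear.codRestrict (dualCode C) (vecMul_mem_dualCode hH)) := by
    intro v w h
    exact Matrix.vecMul_injective_iff.2 hH.1 (congrArg Subtype.val h)
  refine ⟨hinj, (LinearMap.injective_iff_surjective_of_finrank_eq_finrank ?_).1 hinj⟩
  have hr := hH.1.rank_matrix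
  have hk : LinearMap.ker H.mulVecLin = C := by
    ext c; rw [LinearMap.mem_ker, hH.2]; rfl
  have := LinearMap.finrank_range_add_finrank_ker H.mulVecLin
  rw [hk, ← Matrix.rank, hr] at this
  simp only [Fintype.card_fin, Module.finrank_fin_fun] at this
  rw [finrank_dualCode, Module.finrank_fin_fun]
  omega

end Dimension

/-! ### The dual characteristic matrix. -/

section DualRows

variable {F : Type u} [Field F] {n : ℕ} [NeZero n]
variable {C : Submodule F (Fin n → F)} {X : Matrix (Fin n) (Fin n) F} {T : Fin n → Fin n × Fin n}

theorem IsCharPair.exists_partialSum (hX : IsCharPair C X T) (j : Fin n) (w : Fin n → F)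
    (hw : ∀ l, j ∉ halfOpen (T l).1 (T l).2 → w l = 0) :
    ∃ y ∈ dualCode C, ∀ l, partialSum X T j l y = w l := by
  let f : dualCode C →ₗ[F] ({l // j ∈ halfOpen (T l).1 (T l).2} → F) :=
    LinearMap.pi fun l => (partialSum X T j l).comp (dualCode C).subtype
  have hinj : Function.Injective f := by
    rw [← LinearMap.ker_eq_bot, LinearMap.ker_eq_bot']
    intro y hy
    refine Subtype.ext (hX.eq_zero_of_partialSum j y.2 fun l => ?_)
    by_cases hl : j ∈ halfOpen (T l).1 (T l).2
    · exact congrFun hy ⟨l, hl⟩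
    · exact hX.partialSum_eq_zero hl y.2
  have hsurj : Function.Surjective f := by
    refine (LinearMap.injective_iff_surjective_of_finrank_eq_finrank ?_).1 hinj
    rw [finrank_dualCode, Module.finrank_fintype_fun_eq_card, Fintype.card_subtype, hX.card_cover]
  obtain ⟨y, hy⟩ := hsurj fun l => w l
  refine ⟨y, y.2, fun l => ?_⟩
  by_cases hl : j ∈ halfOpen (T l).1 (T l).2
  · exact congrFun hy ⟨l, hl⟩
  · rw [hX.partialSum_eq_zero hl y.2, hw l hl]

/-- `y` is the word of the dual code attached to row `m` of the characteristic matrix `X`. -/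
structure IsDualRow (C : Submodule F (Fin n → F)) (X : Matrix (Fin n) (Fin n) F)
    (T : Fin n → Fin n × Fin n) (m : Fin n) (y : Fin n → F) : Prop where
  mem : y ∈ dualCode C
  partialSum_end : ∀ l, l ≠ m → partialSum X T ((T m).2 + 1) l y = X l (T m).2

theorem IsCharPair.end_add_one_notMem (hX : IsCharPair C X T) (hC' : FullSupport (dualCode C))
    (m : Fin n) : (T m).2 + 1 ∉ halfOpen (T m).1 (T m).2 := by
  have := hX.start_ne_end hC' m
  rw [add_one_mem_halfOpen this]
  grind

theorem IsCharPair.exists_isDualRow (hX : IsCharPair C X T) (hC' : FullSupport (dualCode C))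
    (m : Fin n) : ∃ y, IsDualRow C X T m y := by
  -- These values are admissible: ends are distinct, so any row `l ≠ m` that is nonzero at `b_m` is
  -- still active at `b_m + 1`.
  obtain ⟨y, hy, h⟩ := hX.exists_partialSum ((T m).2 + 1)
    (fun l => if l = m then 0 else X l (T m).2) (by
      intro l hl
      rw [add_one_mem_halfOpen (hX.start_ne_end hC' l)] at hl
      rcases eq_or_ne l m with rfl | hlm
      · simp
      · rw [if_neg hlm]
        by_contra h0
        have hb : (T m).2 ≠ (T l).2 := fun h => hlm (hX.end_injective h.symm)
        have := hX.entry_ne_zero h0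
        tauto)
  exact ⟨y, hy, fun l hl => by rw [h, if_neg hl]⟩

theorem IsDualRow.unique (hX : IsCharPair C X T) (hC' : FullSupport (dualCode C))
    {m : Fin n} {y y' : Fin n → F} (h : IsDualRow C X T m y) (h' : IsDualRow C X T m y') :
    y = y' := by
  refine sub_eq_zero.1 (hX.eq_zero_of_partialSum ((T m).2 + 1) (sub_mem h.mem h'.mem) fun l => ?_)
  rw [map_sub, sub_eq_zero]
  rcases eq_or_ne l m with rfl | hl
  · rw [hX.partialSum_eq_zero (hX.end_add_one_notMem hC' l) h.mem,
      hX.partialSum_eq_zero (hX.end_add_one_notMem hC' l) h'.mem]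
  · rw [h.partialSum_end l hl, h'.partialSum_end l hl]

variable {m : Fin n} {y : Fin n → F}

/-- The row `l` starting at `b_m` has running sum 0 before that step and `X l b_m` after it. -/
theorem IsDualRow.apply_end (hX : IsCharPair C X T) (hC' : FullSupport (dualCode C))
    (h : IsDualRow C X T m y) : y (T m).2 = 1 := by
  obtain ⟨l, hl⟩ := hX.exists_start (T m).2
  have hlm : l ≠ m := by
    rintro rfl
    exact hX.start_ne_end hC' l hl
  have h1 := hX.partialSum_add_one (T m).2 l h.mem
  rw [h.partialSum_end l hlm,
    hX.partialSum_eq_zero (hl ▸ start_notMem_halfOpen _ _) h.mem, zero_add] at h1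
  have h2 := hX.start_ne_zero l
  rw [hl] at h2
  exact mul_left_cancel₀ h2 (by rw [← h1, mul_one])

theorem IsDualRow.partialSum_aux (hX : IsCharPair C X T) (hC' : FullSupport (dualCode C))
    (h : IsDualRow C X T m y) (j : Fin n) : j ∈ halfOpen (T m).1 (T m).2 →
      (∀ l, l ≠ m → partialSum X T j l y = 0) ∧ partialSum X T j m y = - X m (T m).2 ∧
        (j ≠ (T m).2 → y j = 0) := by
  have hne := hX.start_ne_end hC' m
  -- The base point `a_m` lies outside the half-open span, so the claim is vacuous there; the real
  -- start is the case `j = b_m`.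
  refine cyclic_induction (Q := fun j => j ∈ halfOpen (T m).1 (T m).2 →
      (∀ l, l ≠ m → partialSum X T j l y = 0) ∧ partialSum X T j m y = - X m (T m).2 ∧
        (j ≠ (T m).2 → y j = 0)) (T m).1
    (fun h' => absurd h' (start_notMem_halfOpen _ _)) (fun j ih hj => ?_) j
  have hstep := fun l => hX.partialSum_add_one j l h.mem
  by_cases hjb : j = (T m).2
  · subst hjb
    rw [h.apply_end hX hC'] at hstep
    refine ⟨fun l hl => ?_, ?_, fun h' => absurd rfl h'⟩
    · have := hstep l
      rw [h.partialSum_end l hl] at this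
      linear_combination -this
    · have := hstep m
      rw [hX.partialSum_eq_zero (hX.end_add_one_notMem hC' m) h.mem] at this
      linear_combination -this
  · obtain ⟨h1, h2, -⟩ := ih ((add_one_mem_halfOpen hne).2 (Or.inr ⟨hj, hjb⟩))
    have hy : y j = 0 := by
      obtain ⟨l, rfl⟩ := hX.exists_start j
      have hlm : l ≠ m := by
        rintro rfl
        exact start_notMem_halfOpen _ _ hj
      have := hstep l
      rw [h1 l hlm, hX.partialSum_eq_zero (start_notMem_halfOpen _ _) h.mem, zero_add] at this
      exact (mul_eq_zero.1 this.symm).resolve_left (hX.start_ne_zero l)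
    simp only [hy, mul_zero, add_zero] at hstep
    exact ⟨fun l hl => by rw [← hstep, h1 l hl], by rw [← hstep, h2], fun _ => hy⟩

theorem IsDualRow.partialSum_ne (hX : IsCharPair C X T) (hC' : FullSupport (dualCode C))
    (h : IsDualRow C X T m y) {j l : Fin n} (hj : j ∈ halfOpen (T m).1 (T m).2) (hl : l ≠ m) :
    partialSum X T j l y = 0 :=
  (h.partialSum_aux hX hC' j hj).1 l hl

theorem IsDualRow.partialSum_self (hX : IsCharPair C X T) (hC' : FullSupport (dualCode C))
    (h : IsDualRow C X T m y) {j : Fin n} (hj : j ∈ halfOpen (T m).1 (T m).2) :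
    partialSum X T j m y = - X m (T m).2 :=
  (h.partialSum_aux hX hC' j hj).2.1

theorem IsDualRow.apply_start (hX : IsCharPair C X T) (hC' : FullSupport (dualCode C))
    (h : IsDualRow C X T m y) : X m (T m).1 * y (T m).1 = - X m (T m).2 := by
  have hne := hX.start_ne_end hC' m
  have h1 := hX.partialSum_add_one (T m).1 m h.mem
  rw [hX.partialSum_eq_zero (start_notMem_halfOpen _ _) h.mem, zero_add,
    h.partialSum_self hX hC' ((add_one_mem_halfOpen hne).2 (Or.inl rfl))] at h1
  exact h1.symm

theorem IsDualRow.isSpan (hX : IsCharPair C X T) (hC' : FullSupport (dualCode C))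
    (h : IsDualRow C X T m y) : IsSpan y (T m).swap := by
  have hne := hX.start_ne_end hC' m
  refine ⟨?_, ?_, fun j hj => ?_⟩
  · simp [h.apply_end hX hC']
  · intro h0
    have := h.apply_start hX hC'
    rw [Prod.snd_swap] at h0
    rw [h0, mul_zero] at this
    exact hX.end_ne_zero m (neg_eq_zero.1 this.symm)
  · rw [Prod.fst_swap, Prod.snd_swap, mem_closedInterval_iff, mem_halfOpen_swap hne]
    by_contra! hcon
    exact hj ((h.partialSum_aux hX hC' j hcon.2).2.2 hcon.1)

variable {Y : Matrix (Fin n) (Fin n) F}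

/-- All running sums at time `j` cancel: the row `s` starting at `j` contributes `X i j` to index `i
≠ s`, and the term `l = i` contributes `-X i j`. -/
theorem IsCharPair.sum_smul_dualRow (hX : IsCharPair C X T) (hC' : FullSupport (dualCode C))
    (hY : ∀ m, IsDualRow C X T m (Y.row m)) (j : Fin n) :
    ∑ l, ((X l (T l).2)⁻¹ * X l j) • Y.row l = 0 := by
  refine hX.eq_zero_of_partialSum j
    (Submodule.sum_mem _ fun l _ => Submodule.smul_mem _ _ (hY l).mem) fun i => ?_
  obtain ⟨s, hs⟩ := hX.exists_start j
  have hsne := hX.start_ne_end hC' s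
  have hterm : ∀ l, l ≠ s → ((X l (T l).2)⁻¹ * X l j) * partialSum X T j i (Y.row l)
      = if l = i then - X i j else 0 := by
    intro l hls
    by_cases hx : X l j = 0
    · split_ifs with hli
      · subst hli; simp [hx]
      · simp [hx]
    · have hact : j ∈ halfOpen (T l).1 (T l).2 :=
        (hX.entry_ne_zero hx).resolve_left fun h => hls (hX.start_injective (h.symm.trans hs.symm))
      split_ifs with hli
      · subst hli
        rw [(hY l).partialSum_self hX hC' hact]
        field_simp [hX.end_ne_zero l]
      · rw [(hY l).partialSum_ne hX hC' hact (Ne.symm hli), mul_zero]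
  have hs0 : ((X s (T s).2)⁻¹ * X s j) * partialSum X T j i (Y.row s)
      = if s = i then 0 else X i j := by
    split_ifs with hsi
    · subst hsi
      rw [hX.partialSum_eq_zero (hs ▸ start_notMem_halfOpen _ _) (hY s).mem, mul_zero]
    · have h1 := hX.partialSum_add_one j i (hY s).mem
      have h2 := (hY s).apply_start hX hC'
      rw [(hY s).partialSum_ne hX hC' ((add_one_mem_halfOpen hsne).2 (Or.inl hs.symm))
        (Ne.symm hsi)] at h1
      rw [hs] at h2
      have hb := hX.end_ne_zero s
      rw [show partialSum X T j i (Y.row s) = -(X i j * Y.row s j) by linear_combination -h1]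
      field_simp
      linear_combination -(X i j) * h2
  rw [map_sum]
  simp only [map_smul, smul_eq_mul]
  rw [← Finset.add_sum_erase _ _ (Finset.mem_univ s), hs0,
    Finset.sum_congr rfl fun l hl => hterm l (Finset.ne_of_mem_erase hl)]
  rcases eq_or_ne s i with rfl | hsi
  · rw [if_pos rfl, zero_add]
    exact Finset.sum_eq_zero fun l hl => if_neg (Finset.ne_of_mem_erase hl)
  · rw [if_neg hsi, Finset.sum_ite_eq', if_pos (Finset.mem_erase.2 ⟨hsi.symm, Finset.mem_univ _⟩),
      add_neg_cancel]

theorem IsCharPair.span_dualRows (hX : IsCharPair C X T) (hC' : FullSupport (dualCode C))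
    (hY : ∀ m, IsDualRow C X T m (Y.row m)) :
    Submodule.span F (Set.range Y.row) = dualCode C := by
  refine le_antisymm (Submodule.span_le.2 ?_) fun y hy => ?_
  · rintro _ ⟨m, rfl⟩
    exact (hY m).mem
  have hsum : ∑ m, (-(X m (T m).2)⁻¹ * partialSum X T 0 m y) • Y.row m ∈ dualCode C :=
    Submodule.sum_mem _ fun m _ => Submodule.smul_mem _ _ (hY m).mem
  -- At time 0 the active dual rows have a diagonal matrix of running sums with entries `-X m b_m`;
  -- these coefficients invert it.
  have key : y = ∑ m, (-(X m (T m).2)⁻¹ * partialSum X T 0 m y) • Y.row m := by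
    refine sub_eq_zero.1 (hX.eq_zero_of_partialSum 0 (sub_mem hy hsum) fun l => ?_)
    rw [map_sub, sub_eq_zero, map_sum]
    simp only [map_smul, smul_eq_mul]
    have hterm : ∀ m, (-(X m (T m).2)⁻¹ * partialSum X T 0 m y) * partialSum X T 0 l (Y.row m)
        = if m = l then partialSum X T 0 l y else 0 := by
      intro m
      by_cases hact : (0 : Fin n) ∈ halfOpen (T m).1 (T m).2
      · split_ifs with hml
        · subst hml
          rw [(hY m).partialSum_self hX hC' hact]
          field_simp [hX.end_ne_zero m]
        · rw [(hY m).partialSum_ne hX hC' hact (Ne.symm hml), mul_zero]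
      · rw [hX.partialSum_eq_zero hact hy, mul_zero, zero_mul]
        split_ifs with hml
        · subst hml
          exact (hX.partialSum_eq_zero hact hy).symm
        · rfl
    rw [Finset.sum_congr rfl fun m _ => hterm m]
    simp
  rw [key]
  exact Submodule.sum_mem _ fun m _ =>
    Submodule.smul_mem _ _ (Submodule.subset_span ⟨m, rfl⟩)

theorem IsCharPair.dual (hX : IsCharPair C X T) (hC' : FullSupport (dualCode C))
    (hY : ∀ m, IsDualRow C X T m (Y.row m)) :
    IsCharPair (dualCode C) Y (fun l => (T l).swap) where
  span_rows := hX.span_dualRows hC' hY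
  isSpan := fun l => (hY l).isSpan hX hC'
  start_injective := hX.end_injective
  end_injective := hX.start_injective
  card_cover := by
    intro j
    have h1 := hX.card_cover j
    have h2 := Finset.card_filter_add_card_filter_not (s := (Finset.univ : Finset (Fin n)))
      (fun l => j ∈ halfOpen (T l).1 (T l).2)
    rw [Finset.card_univ, Fintype.card_fin] at h2
    have h3 := finrank_code_le C
    have h4 : ∀ l, j ∈ halfOpen (T l).swap.1 (T l).swap.2 ↔ j ∉ halfOpen (T l).1 (T l).2 :=
      fun l => mem_halfOpen_swap (hX.start_ne_end hC' l)
    simp only [h4, finrank_dualCode]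
    omega

end DualRows

/-! ### Complementary row sets as matroid duality. -/

section ComplementaryRows

variable {F : Type u} [Field F]

theorem linearIndependent_complement {ι κ : Type*} [Fintype ι] [DecidableEq ι] [Fintype κ]
    {A B : Matrix ι κ F} {c : ι → F} (hc : ∀ l, c l ≠ 0)
    (hAB : B.transpose * (Matrix.diagonal c * A) = 0) (hrank : A.rank + B.rank = Fintype.card ι)
    {K K' : Finset ι} (hK' : ∀ l, l ∈ K' ↔ l ∉ K) (hcard : K.card = A.rank)
    (hK : LinearIndependent F (fun l : K => A.row l)) :
    LinearIndependent F (fun l : K' => B.row l) := by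
  have hDA : (Matrix.diagonal c * A).rank = A.rank := by
    refine Matrix.rank_mul_eq_right_of_isUnit_det _ _ ?_
    rw [Matrix.det_diagonal]
    exact (Finset.prod_ne_zero_iff.2 fun l _ => hc l).isUnit
  have hker : LinearMap.range (Matrix.diagonal c * A).mulVecLin
      = LinearMap.ker B.transpose.mulVecLin := by
    refine Submodule.eq_of_le_of_finrank_le ?_ ?_
    · rintro _ ⟨u, rfl⟩
      rw [LinearMap.mem_ker, Matrix.mulVecLin_apply, Matrix.mulVecLin_apply, Matrix.mulVec_mulVec,
        hAB, Matrix.zero_mulVec]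
    · have h1 := LinearMap.finrank_range_add_finrank_ker B.transpose.mulVecLin
      rw [← Matrix.rank, Matrix.rank_transpose, Module.finrank_fintype_fun_eq_card] at h1
      rw [← Matrix.rank, hDA]
      omega
  have hspan : Submodule.span F (Set.range fun l : K => A.row l)
      = Submodule.span F (Set.range A.row) := by
    refine Submodule.eq_of_le_of_finrank_le (Submodule.span_mono ?_) ?_
    · rintro _ ⟨l, rfl⟩
      exact ⟨l, rfl⟩
    · rw [finrank_span_eq_card hK, Fintype.card_coe, hcard, Matrix.rank_eq_finrank_span_row]
  rw [Fintype.linearIndependent_iff]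
  intro g hg
  -- A relation among the rows in `K'`, extended by 0, lies in `ker Bᵀ`, hence equals `diag(c) A u`.
  -- It vanishes on `K`, whose rows span the row space of `A`, so `A u = 0`.
  let γ : ι → F := fun l => if h : l ∈ K' then g ⟨l, h⟩ else 0
  have hγ : γ ∈ LinearMap.ker B.transpose.mulVecLin := by
    rw [LinearMap.mem_ker, Matrix.mulVecLin_apply, Matrix.mulVec_transpose, Matrix.vecMul_eq_sum,
      ← hg, ← Finset.sum_subset (Finset.subset_univ K'), ← Finset.sum_coe_sort]
    · refine Finset.sum_congr rfl fun l _ => ?_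
      simp only [γ, l.2, dif_pos]
      rfl
    · intro l _ hl
      simp only [γ, hl, dif_neg, not_false_eq_true, zero_smul]
  rw [← hker] at hγ
  obtain ⟨u, hu⟩ := hγ
  have hcu : ∀ l, γ l = c l * (A.row l ⬝ᵥ u) := by
    intro l
    rw [← hu, Matrix.mulVecLin_apply, ← Matrix.mulVec_mulVec, Matrix.mulVec_diagonal]
    rfl
  have hzero : Submodule.span F (Set.range A.row)
      ≤ LinearMap.ker ((dotProductBilin F F).flip u : (κ → F) →ₗ[F] F) := by
    rw [← hspan, Submodule.span_le]
    rintro _ ⟨l, rfl⟩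
    have h1 := hcu l
    have h2 : γ l = 0 := dif_neg fun h => (hK' l).1 h l.2
    rw [h2] at h1
    exact (mul_eq_zero.1 h1.symm).resolve_left (hc l)
  intro m
  have h1 : A.row m ⬝ᵥ u = 0 := hzero (Submodule.subset_span ⟨m, rfl⟩)
  have h2 := hcu m
  rw [h1, mul_zero] at h2
  simpa [γ] using h2

theorem selectRows_rank_eq_iff {n : ℕ} (X : Matrix (Fin n) (Fin n) F) (K : Finset (Fin n)) :
    (selectRows X K).rank = K.card ↔ LinearIndependent F (fun l : K => X.row l) := by
  rw [linearIndependent_iff_card_eq_finrank_span, Fintype.card_coe, Set.finrank,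
    Matrix.rank_eq_finrank_span_row, eq_comm]
  rfl

end ComplementaryRows

/-! ### A duality criterion for trellises. -/

namespace LinearTrellis

variable {F : Type u} [Field F] {n : ℕ} [NeZero n]

/-- Orthogonality puts `T'.E j` inside the dual of `T.E j`; the dimension bound forces equality. -/
theorem localDual_isomorphic (T T' : LinearTrellis F n) (B : ∀ j, T.V j →ₗ[F] T'.V j →ₗ[F] F)
    (hB : ∀ j, (B j).IsPerfPair)
    (horth : ∀ j, ∀ x ∈ T.E j, ∀ y ∈ T'.E j,
      B j x.1 y.1 + x.2.1 * y.2.1 - B (j + 1) x.2.2 y.2.2 = 0)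
    (hdim : ∀ j, Module.finrank F (T.V j) + 1 + Module.finrank F (T.V (j + 1))
      ≤ Module.finrank F (T.E j) + Module.finrank F (T'.E j)) :
    T.localDual.Isomorphic T' := by
  have hE : ∀ j, T'.E j = (T.localDualWith T'.V B).E j := by
    intro j
    let e : (T'.V j × F × T'.V (j + 1)) →ₗ[F] Module.Dual F (T.V j × F × T.V (j + 1)) :=
      LinearMap.mk₂ F (fun y x => B j x.1 y.1 + x.2.1 * y.2.1 - B (j + 1) x.2.2 y.2.2)
        (fun y y' x => by simp only [Prod.fst_add, Prod.snd_add, map_add]; ring)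
        (fun t y x => by simp only [Prod.smul_fst, Prod.smul_snd, map_smul, smul_eq_mul]; ring)
        (fun y x x' => by
          simp only [Prod.fst_add, Prod.snd_add, map_add, LinearMap.add_apply]; ring)
        (fun t y x => by
          simp only [Prod.smul_fst, Prod.smul_snd, map_smul, LinearMap.smul_apply, smul_eq_mul]
          ring)
    have he : Function.Injective e := by
      rw [← LinearMap.ker_eq_bot, LinearMap.ker_eq_bot']
      rintro ⟨v, b, w⟩ h
      have h' : ∀ x : T.V j × F × T.V (j + 1),
          B j x.1 v + x.2.1 * b - B (j + 1) x.2.2 w = 0 := fun x => LinearMap.congr_fun h x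
      have hv : v = 0 := (hB j).bijective_right.1 (by
        ext x; simpa using h' (x, 0, 0))
      have hw : w = 0 := (hB (j + 1)).bijective_right.1 (by
        ext x; simpa using h' (0, 0, x))
      have hb : b = 0 := by simpa using h' (0, 1, 0)
      rw [hv, hw, hb]; rfl
    let Q : Submodule F (T'.V j × F × T'.V (j + 1)) := (T.localDualWith T'.V B).E j
    change T'.E j = Q
    refine Submodule.eq_of_le_of_finrank_le (fun y hy x hx => horth j x hx y hy) ?_
    have h1 : Q.map e ≤ (T.E j).dualAnnihilator := by
      rintro _ ⟨y, hy, rfl⟩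
      exact (Submodule.mem_dualAnnihilator _).2 hy
    have h2 := Submodule.finrank_mono h1
    rw [← (Submodule.equivMapOfInjective e he Q).finrank_eq] at h2
    have h3 := Subspace.finrank_add_finrank_dualAnnihilator_eq (T.E j)
    rw [Module.finrank_prod, Module.finrank_prod, Module.finrank_self] at h3
    have h4 := hdim j
    omega
  let ψ : ∀ j, T'.V j ≃ₗ[F] Module.Dual F (T.V j) := fun j =>
    LinearEquiv.ofBijective (B j).flip (hB j).bijective_right
  refine ⟨fun j => (ψ j).symm, fun j v a w => ?_⟩
  obtain ⟨v, rfl⟩ := (ψ j).surjective v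
  obtain ⟨w, rfl⟩ := (ψ (j + 1)).surjective w
  change _ ↔ ((ψ j).symm (ψ j v), a, (ψ (j + 1)).symm (ψ (j + 1) w)) ∈ T'.E j
  rw [LinearEquiv.symm_apply_apply, LinearEquiv.symm_apply_apply, hE j]
  rfl

theorem dualToEachOther (T T' : LinearTrellis F n) (B : ∀ j, T.V j →ₗ[F] T'.V j →ₗ[F] F)
    (hB : ∀ j, (B j).IsPerfPair)
    (horth : ∀ j, ∀ x ∈ T.E j, ∀ y ∈ T'.E j,
      B j x.1 y.1 + x.2.1 * y.2.1 - B (j + 1) x.2.2 y.2.2 = 0)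
    (hV : ∀ j, Module.finrank F (T.V j) = Module.finrank F (T'.V j))
    (hdim : ∀ j, Module.finrank F (T.V j) + 1 + Module.finrank F (T.V (j + 1))
      ≤ Module.finrank F (T.E j) + Module.finrank F (T'.E j)) :
    T.DualToEachOther T' := by
  refine ⟨localDual_isomorphic T T' B hB horth hdim,
    localDual_isomorphic T' T (fun j => (B j).flip) (fun j => (hB j).flip)
      (fun j y hy x hx => ?_) fun j => ?_⟩
  · rw [mul_comm]
    exact horth j x hx y hy
  · rw [← hV, ← hV, add_comm (Module.finrank F (T'.E j))]
    exact hdim j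

end LinearTrellis

/-! ### Product trellises and pairings of their states. -/

section ProductTrellis

variable {F : Type u} [Field F] {n : ℕ}

theorem finrank_range_eq_card {ι M : Type*} [Fintype ι] [AddCommGroup M] [Module F M]
    (f : (ι → F) →ₗ[F] M) (A : Finset ι) (hf : ∀ α, f α = 0 ↔ ∀ l ∈ A, α l = 0) :
    Module.finrank F (LinearMap.range f) = A.card := by
  let g : (ι → F) →ₗ[F] (A → F) := LinearMap.funLeft F F (fun l : A => (l : ι))
  have hg : LinearMap.range g = ⊤ :=
    LinearMap.range_eq_top.2 (LinearMap.funLeft_surjective_of_injective _ _ _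
      Subtype.val_injective)
  have hker : LinearMap.ker f = LinearMap.ker g := by
    ext α
    rw [LinearMap.mem_ker, hf, LinearMap.mem_ker]
    exact ⟨fun h => funext fun l => h l l.2, fun h l hl => congrFun h ⟨l, hl⟩⟩
  have h1 := LinearMap.finrank_range_add_finrank_ker f
  have h2 := LinearMap.finrank_range_add_finrank_ker g
  rw [hg, finrank_top, Module.finrank_fintype_fun_eq_card, Fintype.card_coe] at h2
  rw [hker] at h1
  omega

/-- The set of rows whose span contains `j`. -/
def activeRows {ι : Type} [Fintype ι] (S : ι → Fin n × Fin n) (j : Fin n) : Finset ι :=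
  Finset.univ.filter fun l => j ∈ halfOpen (S l).1 (S l).2

theorem mem_activeRows {ι : Type} [Fintype ι] {S : ι → Fin n × Fin n} {j : Fin n} {l : ι} :
    l ∈ activeRows S j ↔ j ∈ halfOpen (S l).1 (S l).2 := by
  simp [activeRows]

variable {ι ι' : Type} [Fintype ι] [DecidableEq ι] [Fintype ι'] [DecidableEq ι']

theorem stateMap_apply (S : ι → Fin n × Fin n) (j : Fin n) (α : ι → F) (l : ι) :
    stateMap F S j α l = if j ∈ halfOpen (S l).1 (S l).2 then α l else 0 := by
  simp [stateMap, stateMatrix, Matrix.vecMul_diagonal]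

theorem stateMap_eq_zero_iff (S : ι → Fin n × Fin n) (j : Fin n) (α : ι → F) :
    stateMap F S j α = 0 ↔ ∀ l ∈ activeRows S j, α l = 0 := by
  simp [funext_iff, stateMap_apply, mem_activeRows]

theorem finrank_productTrellis_V [NeZero n] (G : Matrix ι (Fin n) F) (S : ι → Fin n × Fin n)
    (j : Fin n) : Module.finrank F ((productTrellis G S).V j) = (activeRows S j).card :=
  finrank_range_eq_card _ _ (stateMap_eq_zero_iff S j)

/-- The label at time `j` depends only on coefficients that are visible in one of the two adjacent
states. -/
theorem finrank_productTrellis_E [NeZero n] (G : Matrix ι (Fin n) F) (S : ι → Fin n × Fin n)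
    (j : Fin n) (hG : ∀ l, G l j ≠ 0 → l ∈ activeRows S j ∪ activeRows S (j + 1)) :
    Module.finrank F ((productTrellis G S).E j)
      = (activeRows S j ∪ activeRows S (j + 1)).card := by
  refine finrank_range_eq_card _ _ fun α => ?_
  have h0 : ∀ i, (stateMap F S i).rangeRestrict α = 0 ↔ ∀ l ∈ activeRows S i, α l = 0 := by
    intro i
    rw [← stateMap_eq_zero_iff, ← Submodule.coe_eq_zero]
    rfl
  change ((stateMap F S j).rangeRestrict α, Matrix.vecMul α G j,
    (stateMap F S (j + 1)).rangeRestrict α) = 0 ↔ _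
  rw [Prod.mk_eq_zero, Prod.mk_eq_zero, h0, h0]
  simp only [Finset.mem_union]
  refine ⟨fun h l hl => hl.elim (h.1 l) (h.2.2 l), fun h =>
    ⟨fun l hl => h l (Or.inl hl), ?_, fun l hl => h l (Or.inr hl)⟩⟩
  refine Finset.sum_eq_zero fun l _ => ?_
  change α l * G l j = 0
  by_cases hl : G l j = 0
  · rw [hl, mul_zero]
  · rw [h l (Finset.mem_union.1 (hG l hl)), zero_mul]

/-- The bilinear form on the state spaces of two product trellises at a common time that is given
by a matrix. -/
def stateForm [NeZero n] (G : Matrix ι (Fin n) F) (S : ι → Fin n × Fin n)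
    (G' : Matrix ι' (Fin n) F) (S' : ι' → Fin n × Fin n) (j : Fin n) (P : Matrix ι ι' F) :
    (productTrellis G S).V j →ₗ[F] (productTrellis G' S').V j →ₗ[F] F :=
  (Matrix.toLinearMap₂' F P).domRestrict₁₂ (LinearMap.range (stateMap F S j))
    (LinearMap.range (stateMap F S' j))

theorem stateForm_rangeRestrict [NeZero n] (G : Matrix ι (Fin n) F) (S : ι → Fin n × Fin n)
    (G' : Matrix ι' (Fin n) F) (S' : ι' → Fin n × Fin n) (j : Fin n) (P : Matrix ι ι' F)
    (hP : ∀ l m, P l m ≠ 0 → l ∈ activeRows S j ∧ m ∈ activeRows S' j)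
    (α : ι → F) (β : ι' → F) :
    stateForm G S G' S' j P ((stateMap F S j).rangeRestrict α)
      ((stateMap F S' j).rangeRestrict β) = ∑ l, ∑ m, α l * β m * P l m := by
  change Matrix.toLinearMap₂' F P (stateMap F S j α) (stateMap F S' j β) = _
  rw [Matrix.toLinearMap₂'_apply]
  refine Finset.sum_congr rfl fun l _ => Finset.sum_congr rfl fun m _ => ?_
  by_cases h : P l m = 0
  · simp [h]
  · have h' := hP l m h
    rw [mem_activeRows, mem_activeRows] at h'
    rw [stateMap_apply, stateMap_apply, if_pos h'.1, if_pos h'.2]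
    simp [smul_eq_mul, mul_assoc]

theorem productTrellis_dualToEachOther [NeZero n]
    (G : Matrix ι (Fin n) F) (S : ι → Fin n × Fin n)
    (G' : Matrix ι' (Fin n) F) (S' : ι' → Fin n × Fin n) (P : Fin n → Matrix ι ι' F)
    (hG : ∀ j l, G l j ≠ 0 → l ∈ activeRows S j ∪ activeRows S (j + 1))
    (hG' : ∀ j m, G' m j ≠ 0 → m ∈ activeRows S' j ∪ activeRows S' (j + 1))
    (hP : ∀ j l m, P j l m ≠ 0 → l ∈ activeRows S j ∧ m ∈ activeRows S' j)
    (hstep : ∀ j l m, P (j + 1) l m = P j l m + G l j * G' m j)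
    (hnondeg : ∀ j (α : ι → F), (∀ m, ∑ l, α l * P j l m = 0) → ∀ l ∈ activeRows S j, α l = 0)
    (hV : ∀ j, (activeRows S j).card = (activeRows S' j).card)
    (hE : ∀ j, (activeRows S j).card + 1 + (activeRows S (j + 1)).card
      ≤ (activeRows S j ∪ activeRows S (j + 1)).card
        + (activeRows S' j ∪ activeRows S' (j + 1)).card) :
    (productTrellis G S).DualToEachOther (productTrellis G' S') := by
  have hV' : ∀ j, Module.finrank F ((productTrellis G S).V j)
      = Module.finrank F ((productTrellis G' S').V j) := by
    intro j
    rw [finrank_productTrellis_V, finrank_productTrellis_V, hV]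
  refine LinearTrellis.dualToEachOther _ _ (fun j => stateForm G S G' S' j (P j)) (fun j => ?_)
    (fun j => ?_) hV' (fun j => ?_)
  · have hinj : Function.Injective (stateForm G S G' S' j (P j)) := by
      rw [← LinearMap.ker_eq_bot, LinearMap.ker_eq_bot']
      rintro ⟨_, α, rfl⟩ h
      refine Subtype.ext ((stateMap_eq_zero_iff S j α).2 (hnondeg j α fun m => ?_))
      have h1 := LinearMap.congr_fun h ((stateMap F S' j).rangeRestrict (Pi.single m 1))
      refine (?_ : _ = _).trans h1
      refine Eq.trans ?_ (stateForm_rangeRestrict G S G' S' j (P j) (hP j) α _).symm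
      refine Finset.sum_congr rfl fun l _ => ?_
      rw [Finset.sum_eq_single m]
      · simp
      · intro i _ hi
        simp [hi]
      · simp
    refine LinearMap.IsPerfPair.of_bijective _ ⟨hinj, ?_⟩
    refine (LinearMap.injective_iff_surjective_of_finrank_eq_finrank ?_).1 hinj
    rw [Subspace.dual_finrank_eq, hV']
  · rintro _ ⟨α, rfl⟩ _ ⟨β, rfl⟩
    have h1 := stateForm_rangeRestrict G S G' S' j (P j) (hP j) α β
    have h2 := stateForm_rangeRestrict G S G' S' (j + 1) (P (j + 1)) (hP (j + 1)) α β
    refine (congrArg₂ (· - ·) (congrArg₂ (· + ·) h1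
      (rfl : _ = Matrix.vecMul α G j * Matrix.vecMul β G' j)) h2).trans ?_
    simp only [Matrix.vecMul, dotProduct, Finset.sum_mul_sum, ← Finset.sum_add_distrib,
      ← Finset.sum_sub_distrib]
    refine Finset.sum_eq_zero fun l _ => Finset.sum_eq_zero fun m _ => ?_
    rw [hstep]
    ring
  · rw [finrank_productTrellis_V, finrank_productTrellis_V,
      finrank_productTrellis_E G S j (hG j), finrank_productTrellis_E G' S' j (hG' j)]
    exact hE j

end ProductTrellis

/-! ### Dual selections. -/

section Selections

variable {F : Type u} [Field F] {n : ℕ}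
variable {C : Submodule F (Fin n → F)} {X Y : Matrix (Fin n) (Fin n) F} {T : Fin n → Fin n × Fin n}

theorem IsCharPair.rank_eq (hX : IsCharPair C X T) : X.rank = Module.finrank F C := by
  rw [Matrix.rank_eq_finrank_span_row, hX.span_rows]

theorem IsCharPair.mem_iff_of_isDualSelection (hX : IsCharPair C X T) {k : ℕ}
    {K K' : Finset (Fin n)} (hK : IsDualSelection k T (fun l => (T l).swap) K K') (l : Fin n) :
    l ∈ K' ↔ l ∉ K := by
  have hinj : Function.Injective fun l => (T l).swap := fun i j h =>
    hX.start_injective (congrArg Prod.snd h)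
  have h := Finset.ext_iff.1 hK.complementary (T l).swap
  simp only [Finset.mem_sdiff, Finset.mem_image, Finset.mem_univ, true_and, exists_apply_eq_apply]
    at h
  have hmem : ∀ A : Finset (Fin n), (∃ a ∈ A, (T a).swap = (T l).swap) ↔ l ∈ A := fun A =>
    ⟨fun ⟨_, ha, e⟩ => hinj e ▸ ha, fun ha => ⟨l, ha, rfl⟩⟩
  rwa [hmem, hmem] at h

theorem activeRows_map_subtype (S : Fin n → Fin n × Fin n) (K : Finset (Fin n)) (j : Fin n) :
    (activeRows (fun l : K => S l) j).map (Function.Embedding.subtype _) = K ∩ activeRows S j := by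
  ext l
  simp [mem_activeRows, and_comm]

theorem card_activeRows_subtype (S : Fin n → Fin n × Fin n) (K : Finset (Fin n)) (j : Fin n) :
    (activeRows (fun l : K => S l) j).card = (K ∩ activeRows S j).card := by
  rw [← activeRows_map_subtype, Finset.card_map]

theorem card_activeRows_union_subtype (S : Fin n → Fin n × Fin n) (K : Finset (Fin n))
    (i j : Fin n) :
    (activeRows (fun l : K => S l) i ∪ activeRows (fun l : K => S l) j).card
      = (K ∩ (activeRows S i ∪ activeRows S j)).card := by
  rw [Finset.inter_union_distrib_left, ← activeRows_map_subtype, ← activeRows_map_subtype,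
    ← Finset.map_union, Finset.card_map]

theorem IsCharPair.activeRows_swap (hX : IsCharPair C X T) (hC' : FullSupport (dualCode C))
    (j : Fin n) : activeRows (fun l => (T l).swap) j = (activeRows T j)ᶜ := by
  ext l
  rw [Finset.mem_compl, mem_activeRows, mem_activeRows]
  exact mem_halfOpen_swap (hX.start_ne_end hC' l)

/-- `K'` and the set of active rows both have `n - k` elements, so removing their intersection
leaves equally many. -/
theorem IsCharPair.card_inter_activeRows (hX : IsCharPair C X T) {K K' : Finset (Fin n)}
    (hK' : K' = Kᶜ) (hcard : K'.card = n - Module.finrank F C) (j : Fin n) :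
    (K ∩ activeRows T j).card = (K' ∩ (activeRows T j)ᶜ).card := by
  have h1 : (activeRows T j).card = n - Module.finrank F C := hX.card_cover j
  have h2 := Finset.card_inter_add_card_sdiff (activeRows T j) K'
  have h3 := Finset.card_inter_add_card_sdiff K' (activeRows T j)
  rw [Finset.inter_comm] at h2
  rw [Finset.sdiff_eq_inter_compl, hK', compl_compl, Finset.inter_comm _ K] at h2
  rw [Finset.sdiff_eq_inter_compl] at h3
  rw [hK'] at h3 hcard ⊢
  omega

variable [NeZero n]

/-- The extra 1 comes from the row `s` starting at `j`: it enlarges the first union if `s ∈ K`, and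
the second if `s ∈ K'`. -/
theorem IsCharPair.card_activeRows_le (hX : IsCharPair C X T) (hC' : FullSupport (dualCode C))
    {K K' : Finset (Fin n)} (hK' : K' = Kᶜ) (hcard : K'.card = n - Module.finrank F C)
    (j : Fin n) :
    (K ∩ activeRows T j).card + 1 + (K ∩ activeRows T (j + 1)).card
      ≤ (K ∩ (activeRows T j ∪ activeRows T (j + 1))).card
        + (K' ∩ ((activeRows T j)ᶜ ∪ (activeRows T (j + 1))ᶜ)).card := by
  obtain ⟨s, rfl⟩ := hX.exists_start j
  have hs : s ∉ activeRows T (T s).1 := by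
    rw [mem_activeRows]; exact start_notMem_halfOpen _ _
  have hs' : s ∈ activeRows T ((T s).1 + 1) := by
    rw [mem_activeRows, add_one_mem_halfOpen (hX.start_ne_end hC' s)]; exact Or.inl rfl
  rw [hX.card_inter_activeRows hK' hcard ((T s).1 + 1)]
  by_cases hsK : s ∈ K
  · have h1 : insert s (K ∩ activeRows T (T s).1)
        ⊆ K ∩ (activeRows T (T s).1 ∪ activeRows T ((T s).1 + 1)) := by
      intro l hl; simp only [Finset.mem_insert, Finset.mem_inter, Finset.mem_union] at hl ⊢; grind
    have h2 : K' ∩ (activeRows T ((T s).1 + 1))ᶜ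
        ⊆ K' ∩ ((activeRows T (T s).1)ᶜ ∪ (activeRows T ((T s).1 + 1))ᶜ) :=
      Finset.inter_subset_inter_left Finset.subset_union_right
    have h3 := Finset.card_le_card h1
    have h4 := Finset.card_le_card h2
    rw [Finset.card_insert_of_notMem (by simp [hs])] at h3
    omega
  · have hsK' : s ∈ K' := by rw [hK', Finset.mem_compl]; exact hsK
    have h1 : K ∩ activeRows T (T s).1
        ⊆ K ∩ (activeRows T (T s).1 ∪ activeRows T ((T s).1 + 1)) :=
      Finset.inter_subset_inter_left Finset.subset_union_left
    have h2 : insert s (K' ∩ (activeRows T ((T s).1 + 1))ᶜ)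
        ⊆ K' ∩ ((activeRows T (T s).1)ᶜ ∪ (activeRows T ((T s).1 + 1))ᶜ) := by
      intro l hl
      simp only [Finset.mem_insert, Finset.mem_inter, Finset.mem_union, Finset.mem_compl] at hl ⊢
      grind
    have h3 := Finset.card_le_card h1
    have h4 := Finset.card_le_card h2
    rw [Finset.card_insert_of_notMem (by simp [hs'])] at h4
    omega

theorem IsCharPair.mem_activeRows_of_ne_zero (hX : IsCharPair C X T)
    (hne : ∀ l, (T l).1 ≠ (T l).2) {K : Finset (Fin n)} {j : Fin n} {l : K}
    (h : selectRows X K l j ≠ 0) :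
    l ∈ activeRows (fun l : K => T l) j ∪ activeRows (fun l : K => T l) (j + 1) := by
  rw [Finset.mem_union, mem_activeRows, mem_activeRows, add_one_mem_halfOpen (hne l)]
  have := hX.entry_ne_zero (l := l) h
  tauto

theorem IsCharPair.rank_selectRows_iff (hX : IsCharPair C X T) (hC' : FullSupport (dualCode C))
    (hY : ∀ m, IsDualRow C X T m (Y.row m)) {K K' : Finset (Fin n)}
    (hK : IsDualSelection (Module.finrank F C) T (fun l => (T l).swap) K K') :
    (selectRows X K).rank = Module.finrank F C
      ↔ (selectRows Y K').rank = n - Module.finrank F C := by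
  have hmem := hX.mem_iff_of_isDualSelection hK
  have hrX := hX.rank_eq
  have hrY := (hX.dual hC' hY).rank_eq
  rw [finrank_dualCode] at hrY
  have hle := finrank_code_le C
  let c : Fin n → F := fun l => (X l (T l).2)⁻¹
  have hc : ∀ l, c l ≠ 0 := fun l => inv_ne_zero (hX.end_ne_zero l)
  have hrel : Y.transpose * (Matrix.diagonal c * X) = 0 := by
    ext i j
    have h := congrFun (hX.sum_smul_dualRow hC' hY j) i
    rw [Finset.sum_apply] at h
    rw [Matrix.mul_apply]
    refine (Finset.sum_congr rfl fun l _ => ?_).trans h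
    rw [Matrix.transpose_apply, Matrix.diagonal_mul, mul_comm]
    rfl
  have hrel' : X.transpose * (Matrix.diagonal c * Y) = 0 := by
    have := congrArg Matrix.transpose hrel
    rwa [Matrix.transpose_mul, Matrix.transpose_mul, Matrix.diagonal_transpose,
      Matrix.transpose_transpose, Matrix.transpose_zero, Matrix.mul_assoc] at this
  have hX' := selectRows_rank_eq_iff X K
  have hY' := selectRows_rank_eq_iff Y K'
  rw [hK.card_left] at hX'
  rw [hK.card_right] at hY'
  rw [hX', hY']
  constructor
  · exact linearIndependent_complement hc hrel (by rw [hrX, hrY, Fintype.card_fin]; omega) hmem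
      (hK.card_left.trans hrX.symm)
  · exact linearIndependent_complement hc hrel' (by rw [hrX, hrY, Fintype.card_fin]; omega)
      (fun l => by rw [hmem, not_not]) (hK.card_right.trans hrY.symm)

theorem IsCharPair.productTrellis_dual (hX : IsCharPair C X T) (hC' : FullSupport (dualCode C))
    (hY : ∀ m, IsDualRow C X T m (Y.row m)) {K K' : Finset (Fin n)}
    (hK : IsDualSelection (Module.finrank F C) T (fun l => (T l).swap) K K')
    (hrank : (selectRows Y K').rank = n - Module.finrank F C) :
    (productTrellis (selectRows X K) (fun l : K => T l)).DualToEachOther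
      (productTrellis (selectRows Y K') (fun l : K' => (T l).swap)) := by
  have hmem := hX.mem_iff_of_isDualSelection hK
  have hK' : K' = Kᶜ := Finset.ext fun l => by rw [hmem, Finset.mem_compl]
  have hne := hX.start_ne_end hC'
  have hcard := hK.card_right
  have hspan : Submodule.span F (Set.range (selectRows Y K').row) = dualCode C := by
    refine Submodule.eq_of_le_of_finrank_le (Submodule.span_le.2 ?_) ?_
    · rintro _ ⟨m, rfl⟩
      exact (hY m).mem
    · rw [← Matrix.rank_eq_finrank_span_row, hrank, finrank_dualCode]
  refine productTrellis_dualToEachOther _ _ _ _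
    (fun j => Matrix.of fun (l : K) (m : K') => partialSum X T j l (Y.row m))
    (fun j l => hX.mem_activeRows_of_ne_zero hne)
    (fun j m => (hX.dual hC' hY).mem_activeRows_of_ne_zero fun l => (hne l).symm)
    (fun j l m h => ?_) (fun j l m => hX.partialSum_add_one j l (hY m).mem)
    (fun j α hα l hl => ?_) (fun j => ?_) (fun j => ?_)
  · rw [mem_activeRows, mem_activeRows, Prod.fst_swap, Prod.snd_swap, mem_halfOpen_swap (hne m)]
    refine ⟨?_, fun hm => h ((hY m).partialSum_ne hX hC' hm ?_)⟩
    · by_contra hl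
      exact h (hX.partialSum_eq_zero hl (hY m).mem)
    · intro hlm
      exact (hmem m).1 m.2 (hlm ▸ l.2)
  -- The selected rows of `Y` span the dual code, so `f` vanishes on all of it; a dual word whose
  -- state is the unit vector at `l` then isolates `α l`.
  · let f : (Fin n → F) →ₗ[F] F := ∑ i : K, α i • partialSum X T j i
    have hf : ∀ y, f y = ∑ i : K, α i * partialSum X T j i y := fun y => by
      simp [f, LinearMap.sum_apply]
    have hker : dualCode C ≤ LinearMap.ker f := by
      rw [← hspan, Submodule.span_le]
      rintro _ ⟨m, rfl⟩
      exact (hf _).trans (hα m)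
    obtain ⟨y, hy, hval⟩ := hX.exists_partialSum j (Pi.single (l : Fin n) 1) (by
      intro i hi
      refine Pi.single_eq_of_ne ?_ _
      rintro rfl
      exact hi (mem_activeRows (S := fun l : K => T l).1 hl))
    have h0 : f y = 0 := hker hy
    rw [hf, Finset.sum_eq_single l] at h0
    · rwa [hval, Pi.single_eq_same, mul_one] at h0
    · intro i _ hi
      rw [hval, Pi.single_eq_of_ne (fun h => hi (Subtype.ext h)), mul_zero]
    · simp
  · rw [card_activeRows_subtype T K, card_activeRows_subtype (fun l => (T l).swap) K',
      hX.activeRows_swap hC', hX.card_inter_activeRows hK' hcard]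
  · rw [card_activeRows_subtype T K, card_activeRows_subtype T K,
      card_activeRows_union_subtype T K, card_activeRows_union_subtype (fun l => (T l).swap) K',
      hX.activeRows_swap hC', hX.activeRows_swap hC']
    exact hX.card_activeRows_le hC' hK' hcard j

theorem isDualState_iff {r : ℕ} {H : Matrix (Fin r) (Fin n) F} (hH : IsParityCheck C H)
    {m : Fin n} {v : Fin r → F} :
    IsDualState H X T m v ↔ IsDualRow C X T m (Matrix.vecMul v H) := by
  unfold IsDualState
  simp only [bcjrState_dotProduct]
  exact ⟨fun h => ⟨vecMul_mem_dualCode hH v, fun l hl => (h l hl).symm⟩,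
    fun h l hl => (h.partialSum_end l hl).symm⟩

end Selections

end KVTrellis

theorem theorem4p3 {F : Type u} [Field F] [Finite F] {n : ℕ} [NeZero n]
    (C : Submodule F (Fin n → F))
    (hC : KVTrellis.FullSupport C) (hC' : KVTrellis.FullSupport (KVTrellis.dualCode C))
    (X : Matrix (Fin n) (Fin n) F) (T : Fin n → Fin n × Fin n)
    (hX : KVTrellis.IsCharPair C X T) :
    ∃ Y : Matrix (Fin n) (Fin n) F,
      -- `Y` is a characteristic matrix of the dual code, and its spans are the reversed ones
      KVTrellis.IsCharPair (KVTrellis.dualCode C) Y (fun l => (T l).swap) ∧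
      -- the explicit construction of `Y`, from any parity check matrix of the code
      (∀ (r : ℕ) (H : Matrix (Fin r) (Fin n) F), KVTrellis.IsParityCheck C H →
        ∀ m, ∃ v : Fin r → F, KVTrellis.IsDualState H X T m v ∧
          (∀ v', KVTrellis.IsDualState H X T m v' → v' = v) ∧
          Y.row m = Matrix.vecMul v H) ∧
      ∀ K K' : Finset (Fin n),
        KVTrellis.IsDualSelection (Module.finrank F C) T (fun l => (T l).swap) K K' →
        ((KVTrellis.selectRows X K).rank = Module.finrank F C ↔
          (KVTrellis.selectRows Y K').rank = n - Module.finrank F C) ∧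
        ((KVTrellis.selectRows X K).rank = Module.finrank F C →
          (KVTrellis.productTrellis (KVTrellis.selectRows X K)
            (fun l : K => T l)).DualToEachOther
          (KVTrellis.productTrellis (KVTrellis.selectRows Y K')
            (fun l : K' => (T l).swap))) := by
  choose y hy using fun m => hX.exists_isDualRow hC' m
  have hY : ∀ m, KVTrellis.IsDualRow C X T m ((Matrix.of y).row m) := hy
  refine ⟨Matrix.of y, hX.dual hC' hY, fun r H hH m => ?_, fun K K' hK => ?_⟩
  · obtain ⟨v, hv⟩ := (KVTrellis.vecMul_bijective hH).2 ⟨y m, (hy m).mem⟩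
    have hv' : Matrix.vecMul v H = y m := congrArg Subtype.val hv
    refine ⟨v, (KVTrellis.isDualState_iff hH).2 (hv' ▸ hy m), fun v' h => ?_, hv'.symm⟩
    have hrow : KVTrellis.IsDualRow C X T m (Matrix.vecMul v H) := hv' ▸ hy m
    exact (KVTrellis.vecMul_bijective hH).1
      (Subtype.ext (((KVTrellis.isDualState_iff hH).1 h).unique hX hC' hrow))
  · have hiff := hX.rank_selectRows_iff hC' hY hK
    exact ⟨hiff, fun h => hX.productTrellis_dual hC' hY hK (hiff.1 h)⟩
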